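/- Let $d\ge 2$, let $\mathbb T^d=\mathbb R^d/2\pi\mathbb Z^d$ be identified with $]-\pi,\pi]^d$, let $|\cdot|$ be the Euclidean norm, and let $I$ be a finite index set. For each $i\in I$ let $g_{0,i}:\mathbb T^d\to\mathbb C$ be continuous with $g_{0,i}(q)=\overline{g_{0,i}(-q)}$; let $\nu_i:\mathbb T^d\to[0,\infty)$ be continuous, $C^\infty$ on $\mathbb T^d\setminus\{0\}$, and strictly positive there; and let $\zeta_i:\mathbb T^d\setminus\{0\}\to[0,\infty)$ be continuous. Put, for $x\in\mathbb Z^d$ and $t\in\mathbb R$, $$f_i(x,t)=\int_{\mathbb T^d}\frac{d^dq}{(2\pi)^d}\,|g_{0,i}(q)|^2\Bigl(\zeta_i(q)\,e^{iq\cdot x}e^{it\nu_i(q)}+(1+\zeta_i(q))\,e^{-iq\cdot x}e^{-it\nu_i(q)}\Bigr).$$ Assume that for every $i\in I$: - the (closed) support of $g_{0,i}$ is contained in the open ball $\{q\in\mathbb T^d:|q|<\pi\}$; - $|g_{0,i}(q)|$ and $\zeta_i(q)$ depend only on $|q|$ for $0<|q|<\pi$; - $\nu_i(q)=|q|$ on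 the support of $g_{0,i}$; - the functions $\psi_{i,\pm}$ on $]0,\pi]$ defined by $\psi_{i,+}(|q|)=|g_{0,i}(q)|^2\zeta_i(q)$ and $\psi_{i,-}(|q|)=|g_{0,i}(q)|^2(1+\zeta_i(q))$ belong to $C^2(]0,\pi])$, and $$r^{\min\{d-3,\frac{d-1}{2}\}}\,\psi_{i,\pm}(r),\qquad r^{d-2}\,\psi_{i,\pm}'(r),\qquad r^{d-1}\,\psi_{i,\pm}''(r)$$ are integrable on $[0,\pi]$. Then the integrals defining $f_i(x,t)$ converge absolutely for all $i\in I$, $x\in\mathbb Z^d$, $t\in\mathbb R$, and $$\lim_{n\to\infty}\frac1n\int_0^\infty dt\,\sup_{x\in\mathbb Z^d,\;i\in I}|f_i(x,t)|\,e^{-|x|/n}=0 .$$ -/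

import Mathlib

open MeasureTheory Filter
open scoped Topology ENNReal Real ContDiff

/-- Momentum space: the universal cover `ℝ^d` of the torus `𝕋^d = ℝ^d / 2πℤ^d`, with its Euclidean
norm. Functions on the torus are represented by their `2πℤ^d`-periodic lifts. -/
abbrev Momentum (d : ℕ) : Type := EuclideanSpace ℝ (Fin d)

/-- A site `x ∈ ℤ^d` of the lattice, seen as a vector of Euclidean space. -/
def latticePoint {d : ℕ} (x : Fin d → ℤ) : EuclideanSpace ℝ (Fin d) :=
  WithLp.toLp 2 (fun j => (x j : ℝ))

/-- The hypercube `]-π, π]^d`, with which the torus is identified. -/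
def torusCube (d : ℕ) : Set (Momentum d) :=
  {q | ∀ j, q j ∈ Set.Ioc (-π) π}

/-- All lifts `2πk`, `k ∈ ℤ^d`, of the origin of the torus. -/
def zeroLifts (d : ℕ) : Set (Momentum d) :=
  Set.range fun k : Fin d → ℤ => (2 * π) • latticePoint k

/-- `u` is the lift of a function on the torus. -/
def IsTorusFunction {d : ℕ} {α : Type*} (u : Momentum d → α) : Prop :=
  ∀ (q : Momentum d) (k : Fin d → ℤ), u (q + (2 * π) • latticePoint k) = u q

/-- The data of one bosonic bath in the thermodynamic limit, with their standing regularity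
assumptions. -/
structure BosonBath (d : ℕ) where
  /-- the form factor `g₀ : 𝕋^d → ℂ` -/
  formFactor : Momentum d → ℂ
  formFactor_periodic : IsTorusFunction formFactor
  formFactor_continuous : Continuous formFactor
  formFactor_neg : ∀ q, formFactor q = star (formFactor (-q))
  /-- the dispersion relation `ν : 𝕋^d → ℝ₊` -/
  dispersion : Momentum d → ℝ
  dispersion_periodic : IsTorusFunction dispersion
  dispersion_continuous : Continuous dispersion
  dispersion_smooth : ContDiffOn ℝ ∞ dispersion (zeroLifts d)ᶜ
  dispersion_nonneg : ∀ q, 0 ≤ dispersion q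
  dispersion_pos : ∀ q, q ∉ zeroLifts d → 0 < dispersion q
  /-- the occupation numbers `ζ : 𝕋^d ∖ {0} → ℝ₊` (the value at the origin is irrelevant) -/
  occupation : Momentum d → ℝ
  occupation_periodic : IsTorusFunction occupation
  occupation_continuous : ContinuousOn occupation (zeroLifts d)ᶜ
  occupation_nonneg : ∀ q, q ∉ zeroLifts d → 0 ≤ occupation q

namespace BosonBath

/-- The integrand
`|g₀(q)|² (ζ(q) e^{i q·x} e^{i t ν(q)} + (1 + ζ(q)) e^{-i q·x} e^{-i t ν(q)})`
of the correlation function. -/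
noncomputable def correlationIntegrand {d : ℕ} (b : BosonBath d) (x : Fin d → ℤ) (t : ℝ)
    (q : Momentum d) : ℂ :=
  ((‖b.formFactor q‖ ^ 2 : ℝ) : ℂ) *
    ((b.occupation q : ℂ)
        * Complex.exp (Complex.I * ((inner ℝ q (latticePoint x) : ℝ) : ℂ))
        * Complex.exp (Complex.I * ((t * b.dispersion q : ℝ) : ℂ))
      + (1 + (b.occupation q : ℂ))
        * Complex.exp (-(Complex.I * ((inner ℝ q (latticePoint x) : ℝ) : ℂ)))
        * Complex.exp (-(Complex.I * ((t * b.dispersion q : ℝ) : ℂ))))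

/-- The infinite-volume bath correlation function `f(x,t)`: the integral of the integrand above
over the torus with respect to `d^d q / (2π)^d`. -/
noncomputable def correlation {d : ℕ} (b : BosonBath d) (x : Fin d → ℤ) (t : ℝ) : ℂ :=
  (((2 * π) ^ d : ℝ) : ℂ)⁻¹ * ∫ q in torusCube d, b.correlationIntegrand x t q

/-- `|g₀|` and `ζ` depend only on the Euclidean modulus of the momentum, in the punctured ball
`0 < |q| < π`. -/
def IsRadial {d : ℕ} (b : BosonBath d) : Prop :=
  ∀ q q' : Momentum d, 0 < ‖q‖ → ‖q‖ < π → ‖q'‖ = ‖q‖ →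
    ‖b.formFactor q'‖ = ‖b.formFactor q‖ ∧ b.occupation q' = b.occupation q

end BosonBath

/-- The regularity assumed of a radial profile `ψ` in dimension `d`: it is `C²` on `]0,π]`, and
`r^{min(d-3,(d-1)/2)} ψ(r)`, `r^{d-2} ψ'(r)`, `r^{d-1} ψ''(r)` are integrable (the endpoints
of `[0,π]` form a null set, and in the open interval `deriv` is the classical derivative). -/
def AdmissibleProfile (d : ℕ) (ψ : ℝ → ℝ) : Prop :=
  ContDiffOn ℝ 2 ψ (Set.Ioc 0 π) ∧
  IntegrableOn (fun r : ℝ => r ^ (min ((d : ℝ) - 3) (((d : ℝ) - 1) / 2)) * ψ r)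
    (Set.Ioo 0 π) ∧
  IntegrableOn (fun r : ℝ => r ^ ((d : ℝ) - 2) * deriv ψ r) (Set.Ioo 0 π) ∧
  IntegrableOn (fun r : ℝ => r ^ ((d : ℝ) - 1) * deriv (deriv ψ) r) (Set.Ioo 0 π)

/-- The integrability assumption on the correlation functions of a family of baths:
`(1/n) ∫₀^∞ sup_{x,i} |f_i(x,t)| e^{-|x|/n} dt → 0` as `n → ∞`. Suprema and time integral are
taken in `[0,∞]`, so that the limit in particular says that they are finite for large `n`. -/
def CorrelationDecay {d : ℕ} {ι : Type*} (b : ι → BosonBath d) : Prop :=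
  Tendsto
    (fun n : ℕ => (n : ℝ≥0∞)⁻¹ *
      ∫⁻ t in Set.Ioi (0 : ℝ), ⨆ (x : Fin d → ℤ) (i : ι),
        ENNReal.ofReal (‖(b i).correlation x t‖ * Real.exp (-(‖latticePoint x‖ / n))))
    atTop (𝓝 0)

/-! On the support of $g_0$ the dispersion is $|q|$ and the amplitudes are radial, so in polar
coordinates $f(x,t)$ splits into two waves whose radial integrals are the Fourier transform of
$G(r)=r^{d-1}\psi(r)$ at $\pm u$, $u=t+\theta\cdot x$. The hypotheses make $G''$ integrable and $G$
zero at both ends of $]0,\pi[$; two integrations by parts give $O(1/(1+u^2))$. Hence $|f(x,t)|\le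
C\,K(x,t)$, where $K$ (`sphereKernel`) integrates $1/(1+u^2)$ over the sphere.

For $t\ge 2|x|$ the phase is at least $t/2$ and $K=O(1/(1+t^2))$, integrable in time. For $t\le
2|x|$ the phase may vanish for some $\theta$, but only on a null set of the sphere; compactness
gives $K\le\varepsilon$ uniformly once $t>T$ (`exists_forall_sphereKernel_le`). There $e^{-|x|/n}\le
e^{-t/(2n)}$, so this region contributes at most $2nC\varepsilon$. Times $t\le T$ contribute $O(1)$.
Dividing by $n$ leaves $2C\varepsilon+O(1/n)$. -/

/-! ### Fourier decay of radial profiles -/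

/-- A function with integrable derivative on a bounded open interval extends continuously to the
closed interval. -/
theorem exists_continuousOn_eqOn_of_integrableOn_deriv {a b : ℝ} (hab : a < b) {f f' : ℝ → ℝ}
    (hf : ∀ x ∈ Set.Ioo a b, HasDerivAt f (f' x) x) (hf' : IntegrableOn f' (Set.Ioo a b)) :
    ∃ g : ℝ → ℝ, ContinuousOn g (Set.Icc a b) ∧ Set.EqOn f g (Set.Ioo a b) := by
  obtain ⟨c, hac, hcb⟩ := exists_between hab
  have hint : IntegrableOn f' (Set.Icc a b) := by rwa [integrableOn_Icc_iff_integrableOn_Ioo]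
  refine ⟨fun x => f c + ∫ t in c..x, f' t, continuousOn_const.add ?_, ?_⟩
  · have := intervalIntegral.continuousOn_primitive_interval' (a := c) (b₁ := a) (b₂ := b)
      (f := f') (μ := volume) ?_ ?_
    · rwa [Set.uIcc_of_le hab.le] at this
    · rwa [intervalIntegrable_iff_integrableOn_Ioo_of_le hab.le]
    · rw [Set.uIcc_of_le hab.le]; exact ⟨hac.le, hcb.le⟩
  · intro x hx
    have hsub : Set.uIcc c x ⊆ Set.Ioo a b := by
      intro y hy
      rcases Set.mem_uIcc.1 hy with h | h
      · exact ⟨hac.trans_le h.1, h.2.trans_lt hx.2⟩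
      · exact ⟨hx.1.trans_le h.1, h.2.trans_lt hcb⟩
    have := intervalIntegral.integral_eq_sub_of_hasDerivAt (f := f) (f' := f') (a := c) (b := x)
      (fun y hy => hf y (hsub hy))
      ((hf'.mono_set hsub).intervalIntegrable)
    simp only [this]; ring

/-- If `f` has a limit at `0+` and `f(r) / r ^ 2` is integrable near `0`, the limit vanishes. -/
theorem eq_zero_of_tendsto_of_integrableOn_div_sq {R L : ℝ} (hR : 0 < R) {f : ℝ → ℝ}
    (hL : Tendsto f (𝓝[>] 0) (𝓝 L)) (hf : IntegrableOn (fun r => f r / r ^ 2) (Set.Ioo 0 R)) :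
    L = 0 := by
  by_contra hne
  have hpos : 0 < |L| := abs_pos.2 hne
  have hev : ∀ᶠ r in 𝓝[>] (0 : ℝ), |L| / 2 < |f r| :=
    hL.abs.eventually_const_lt (by linarith)
  obtain ⟨s, hs, hsf⟩ := mem_nhdsGT_iff_exists_Ioo_subset.1 hev
  have hs : 0 < s := hs
  set m := min s R
  have hm : 0 < m := lt_min hs hR
  have hint : IntegrableOn (fun r => f r / r ^ 2) (Set.Ioo 0 m) :=
    hf.mono_set (Set.Ioo_subset_Ioo_right (min_le_right _ _))
  -- Near $0$, $|f|>|L|/2$, so $r^{-2}\le(2/|L|)\,|f(r)/r^2|$ would be integrable.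
  have h2 : IntegrableOn (fun r : ℝ => r ^ (-2 : ℝ)) (Set.Ioo 0 m) := by
    refine Integrable.mono' (hint.norm.const_mul (2 / |L|)) ?_ ?_
    · exact (measurable_id.pow_const _).aestronglyMeasurable
    · filter_upwards [ae_restrict_mem measurableSet_Ioo] with r hr
      have h3 : |L| / 2 < |f r| := hsf ⟨hr.1, hr.2.trans_le (min_le_left _ _)⟩
      have h4 : (0 : ℝ) < r ^ 2 := pow_pos hr.1 2
      have h5 : r ^ (-2 : ℝ) = 1 / r ^ 2 := by
        rw [Real.rpow_neg hr.1.le, one_div]; norm_cast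
      rw [h5, Real.norm_eq_abs, Real.norm_eq_abs, abs_div, abs_div, abs_one, abs_of_pos h4,
        ← mul_div_assoc]
      gcongr
      rw [div_mul_eq_mul_div, le_div_iff₀ hpos]
      linarith
  rw [intervalIntegral.integrableOn_Ioo_rpow_iff hm] at h2
  norm_num at h2

/-- Quadratic decay of the Fourier integral of a function on `]0, R[` with integrable second
derivative which vanishes at both endpoints. -/
theorem exists_norm_fourier_integral_le {R : ℝ} (hR : 0 < R) {G G' G'' : ℝ → ℝ}
    (h1 : ∀ x ∈ Set.Ioo 0 R, HasDerivAt G (G' x) x)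
    (h2 : ∀ x ∈ Set.Ioo 0 R, HasDerivAt G' (G'' x) x)
    (hint : IntegrableOn G'' (Set.Ioo 0 R))
    (hdiv : IntegrableOn (fun r => G r / r ^ 2) (Set.Ioo 0 R))
    (hlim : Tendsto G (𝓝[<] R) (𝓝 0)) :
    IntegrableOn G (Set.Ioo 0 R) ∧ ∃ C : ℝ, 0 ≤ C ∧ ∀ u : ℝ,
      ‖∫ r in Set.Ioo 0 R, (G r : ℂ) * Complex.exp (Complex.I * ((u * r : ℝ) : ℂ))‖
        ≤ C / (1 + u ^ 2) := by
  obtain ⟨g1, hg1, he1⟩ := exists_continuousOn_eqOn_of_integrableOn_deriv hR h2 hint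
  have hG'int : IntegrableOn G' (Set.Ioo 0 R) :=
    ((hg1.integrableOn_Icc).mono_set Set.Ioo_subset_Icc_self).congr_fun he1.symm measurableSet_Ioo
  obtain ⟨g0, hg0, he0⟩ := exists_continuousOn_eqOn_of_integrableOn_deriv hR h1 hG'int
  have hGint : IntegrableOn G (Set.Ioo 0 R) :=
    ((hg0.integrableOn_Icc).mono_set Set.Ioo_subset_Icc_self).congr_fun he0.symm measurableSet_Ioo
  have hl : ∀ {f g : ℝ → ℝ}, ContinuousOn g (Set.Icc 0 R) → Set.EqOn f g (Set.Ioo 0 R) →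
      Tendsto f (𝓝[>] 0) (𝓝 (g 0)) := by
    intro f g hg he
    have : Tendsto g (𝓝[>] 0) (𝓝 (g 0)) :=
      ((hg 0 ⟨le_rfl, hR.le⟩).mono_of_mem_nhdsWithin
        (mem_of_superset (Ioo_mem_nhdsGT hR) Set.Ioo_subset_Icc_self)).tendsto
    exact this.congr' (mem_of_superset (Ioo_mem_nhdsGT hR) fun x hx => (he hx).symm)
  have hr : ∀ {f g : ℝ → ℝ}, ContinuousOn g (Set.Icc 0 R) → Set.EqOn f g (Set.Ioo 0 R) →
      Tendsto f (𝓝[<] R) (𝓝 (g R)) := by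
    intro f g hg he
    have : Tendsto g (𝓝[<] R) (𝓝 (g R)) :=
      ((hg R ⟨hR.le, le_rfl⟩).mono_of_mem_nhdsWithin
        (mem_of_superset (Ioo_mem_nhdsLT hR) Set.Ioo_subset_Icc_self)).tendsto
    exact this.congr' (mem_of_superset (Ioo_mem_nhdsLT hR) fun x hx => (he hx).symm)
  have hG0 : Tendsto G (𝓝[>] 0) (𝓝 0) := by
    have h := hl hg0 he0
    rwa [eq_zero_of_tendsto_of_integrableOn_div_sq hR h hdiv] at h
  set A := ∫ r in Set.Ioo 0 R, ‖G r‖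
  set B := ∫ r in Set.Ioo 0 R, ‖G'' r‖
  have hA : 0 ≤ A := integral_nonneg fun _ => norm_nonneg _
  have hB : 0 ≤ B := integral_nonneg fun _ => norm_nonneg _
  -- `A` bounds $|J|$ and the bracket bounds $u^2|J|$; their sum bounds $(1+u^2)|J|$.
  refine ⟨hGint, A + (|g1 R| + |g1 0| + B), by positivity, fun u => ?_⟩
  set e : ℝ → ℂ := fun r => Complex.exp (Complex.I * ((u * r : ℝ) : ℂ))
  have hnorm : ∀ r, ‖e r‖ = 1 := fun r => by
    simp only [e]; rw [mul_comm]; exact Complex.norm_exp_ofReal_mul_I _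
  have hecont : Continuous e := by fun_prop
  have hede : ∀ r, HasDerivAt e (Complex.I * u * e r) r := by
    intro r
    have h : HasDerivAt (fun r : ℝ => Complex.I * ((u * r : ℝ) : ℂ)) (Complex.I * u) r := by
      have := ((hasDerivAt_id r).const_mul u).ofReal_comp.const_mul Complex.I
      simpa using this
    have := h.cexp
    rw [mul_comm] at this; exact this
  have hmulint : ∀ {f : ℝ → ℝ}, IntegrableOn f (Set.Ioo 0 R) →
      IntegrableOn (fun r => (f r : ℂ) * e r) (Set.Ioo 0 R) := by
    intro f hf
    exact hf.ofReal.mul_bdd (c := 1) hecont.aestronglyMeasurable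
      (Eventually.of_forall fun r => (hnorm r).le)
  have hbd : ∀ {f : ℝ → ℝ}, ‖∫ r in Set.Ioo 0 R, (f r : ℂ) * e r‖ ≤ ∫ r in Set.Ioo 0 R, ‖f r‖ := by
    intro f
    refine (norm_integral_le_integral_norm _).trans_eq ?_
    simp [hnorm]
  set J := ∫ r in Set.Ioo 0 R, (G r : ℂ) * e r
  -- Both integrations by parts at once: $(G'-iuG)e^{iur}$ has derivative $(G''+u^2G)e^{iur}$. At
  -- the endpoints $G$ tends to $0$, so only the limits of $G'$ survive.
  have key : (∫ r in Set.Ioo 0 R, (G'' r : ℂ) * e r) + (u : ℂ) ^ 2 * J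
      = g1 R * e R - g1 0 * e 0 := by
    have hF := intervalIntegral.integral_eq_sub_of_hasDerivAt_of_tendsto
      (f := fun r => ((G' r : ℂ) - Complex.I * u * G r) * e r)
      (f' := fun r => (G'' r : ℂ) * e r + (u : ℂ) ^ 2 * ((G r : ℂ) * e r))
      (fa := ((g1 0 : ℂ) - Complex.I * u * (0 : ℝ)) * e 0)
      (fb := ((g1 R : ℂ) - Complex.I * u * (0 : ℝ)) * e R) hR ?_ ?_ ?_ ?_
    · rw [intervalIntegral.integral_of_le hR.le, integral_Ioc_eq_integral_Ioo,
        integral_add (hmulint hint) ((hmulint hGint).const_mul _), integral_const_mul] at hF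
      simpa using hF
    · intro r hr
      have := ((h2 r hr).ofReal_comp.sub
        ((h1 r hr).ofReal_comp.const_mul (Complex.I * u))).mul (hede r)
      refine this.congr_deriv ?_
      simp only [Pi.sub_apply]
      linear_combination (-(u : ℂ) ^ 2 * G r * e r) * Complex.I_sq
    · rw [intervalIntegrable_iff_integrableOn_Ioo_of_le hR.le]
      exact (hmulint hint).add ((hmulint hGint).const_mul _)
    · refine Tendsto.mul (((Complex.continuous_ofReal.tendsto _).comp (hl hg1 he1)).sub
        (((Complex.continuous_ofReal.tendsto _).comp hG0).const_mul _)) ?_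
      exact hecont.continuousWithinAt.tendsto
    · refine Tendsto.mul (((Complex.continuous_ofReal.tendsto _).comp (hr hg1 he1)).sub
        (((Complex.continuous_ofReal.tendsto _).comp hlim).const_mul _)) ?_
      exact hecont.continuousWithinAt.tendsto
  have hJ2 : u ^ 2 * ‖J‖ ≤ |g1 R| + |g1 0| + B := by
    have : (u : ℂ) ^ 2 * J = g1 R * e R - g1 0 * e 0 - ∫ r in Set.Ioo 0 R, (G'' r : ℂ) * e r := by
      rw [← key]; ring
    calc u ^ 2 * ‖J‖ = ‖(u : ℂ) ^ 2 * J‖ := by simp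
      _ ≤ ‖(g1 R : ℂ) * e R‖ + ‖(g1 0 : ℂ) * e 0‖
          + ‖∫ r in Set.Ioo 0 R, (G'' r : ℂ) * e r‖ := by
        rw [this]; exact (norm_sub_le _ _).trans (add_le_add_left (norm_sub_le _ _) _)
      _ ≤ _ := by
        simp only [norm_mul, hnorm, mul_one, Complex.norm_real, Real.norm_eq_abs]
        gcongr
        exact hbd
  have hJ1 : ‖J‖ ≤ A := hbd
  rw [le_div_iff₀ (by positivity)]
  linarith

/-- Quadratic decay of the Fourier integral of an admissible radial profile, taken against the
radial part of Lebesgue measure. -/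
theorem AdmissibleProfile.exists_norm_fourier_integral_le {d : ℕ} (hd : 2 ≤ d) {ψ : ℝ → ℝ}
    (hψ : AdmissibleProfile d ψ) (hπ : ψ π = 0) :
    IntegrableOn (fun r => r ^ (d - 1) * ψ r) (Set.Ioo 0 π) ∧ ∃ C : ℝ, 0 ≤ C ∧ ∀ u : ℝ,
      ‖∫ r in Set.Ioo 0 π, ((r ^ (d - 1) * ψ r : ℝ) : ℂ)
        * Complex.exp (Complex.I * ((u * r : ℝ) : ℂ))‖ ≤ C / (1 + u ^ 2) := by
  obtain ⟨hC2, hi0, hi1, hi2⟩ := hψ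
  have hcast : ((d - 1 : ℕ) : ℝ) = (d : ℝ) - 1 := by
    rw [Nat.cast_sub (by omega), Nat.cast_one]
  have hd' : (2 : ℝ) ≤ d := by exact_mod_cast hd
  set p : ℝ := (d : ℝ) - 1 with hp
  have hC2' : ContDiffOn ℝ 2 ψ (Set.Ioo 0 π) := hC2.mono Set.Ioo_subset_Ioc_self
  have hψ1 : ∀ x ∈ Set.Ioo 0 π, HasDerivAt ψ (deriv ψ x) x := fun x hx =>
    ((hC2'.contDiffAt (Ioo_mem_nhds hx.1 hx.2)).differentiableAt (by norm_num)).hasDerivAt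
  have hψ2 : ∀ x ∈ Set.Ioo 0 π, HasDerivAt (deriv ψ) (deriv (deriv ψ) x) x := by
    intro x hx
    have h := (contDiffOn_succ_iff_deriv_of_isOpen (n := 1) isOpen_Ioo).1
      (by rw [one_add_one_eq_two]; exact hC2')
    exact ((h.2.2.contDiffAt (Ioo_mem_nhds hx.1 hx.2)).differentiableAt (by norm_num)).hasDerivAt
  have hi0' : IntegrableOn (fun r : ℝ => r ^ (p - 2) * ψ r) (Set.Ioo 0 π) := by
    set m := min ((d : ℝ) - 3) (((d : ℝ) - 1) / 2)
    -- $p-2=d-3\ge m$, so $r^{d-3}$ is $r^m$ times a power bounded on $]0,\pi[$.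
    have hm : 0 ≤ p - 2 - m := by
      have : m ≤ (d : ℝ) - 3 := min_le_left _ _
      linarith
    have h := Integrable.bdd_mul (c := π ^ (p - 2 - m)) (f := fun r : ℝ => r ^ (p - 2 - m)) hi0
      (measurable_id.pow_const _).aestronglyMeasurable ?_
    · refine IntegrableOn.congr_fun h (fun r hr => ?_) measurableSet_Ioo
      rw [← mul_assoc, ← Real.rpow_add hr.1]
      congr 2; ring
    · filter_upwards [ae_restrict_mem measurableSet_Ioo] with r hr
      rw [Real.norm_of_nonneg (Real.rpow_nonneg hr.1.le _)]
      exact Real.rpow_le_rpow hr.1.le hr.2.le hm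
  have hG : ∀ r ∈ Set.Ioo 0 π, r ^ (d - 1) * ψ r = r ^ p * ψ r := fun r _ => by
    rw [← hcast, Real.rpow_natCast]
  have hpow : ∀ (s x : ℝ), x ∈ Set.Ioo 0 π → HasDerivAt (fun r : ℝ => r ^ s) (s * x ^ (s - 1)) x :=
    fun s x hx => Real.hasDerivAt_rpow_const (Or.inl hx.1.ne')
  refine _root_.exists_norm_fourier_integral_le Real.pi_pos
    (G := fun r => r ^ (d - 1) * ψ r)
    (G' := fun r => p * (r ^ (p - 1) * ψ r) + r ^ p * deriv ψ r)
    (G'' := fun r => p * (p - 1) * (r ^ (p - 2) * ψ r) + 2 * p * (r ^ (p - 1) * deriv ψ r)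
      + r ^ p * deriv (deriv ψ) r) ?_ ?_ ?_ ?_ ?_
  · intro x hx
    have h := (hpow p x hx).mul (hψ1 x hx)
    refine (h.congr_of_eventuallyEq ?_).congr_deriv (by ring)
    filter_upwards [Ioo_mem_nhds hx.1 hx.2] with r hr
    exact hG r hr
  · intro x hx
    have h := (((hpow (p - 1) x hx).mul (hψ1 x hx)).const_mul p).add
      ((hpow p x hx).mul (hψ2 x hx))
    refine h.congr_deriv ?_
    rw [show p - 1 - 1 = p - 2 by ring]; ring
  · have e1 : (d : ℝ) - 2 = p - 1 := by rw [hp]; ring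
    rw [e1] at hi1
    exact ((hi0'.const_mul _).add (hi1.const_mul _)).add hi2
  · refine hi0'.congr_fun (fun r hr => ?_) measurableSet_Ioo
    simp only
    rw [hG r hr, Real.rpow_sub hr.1, Real.rpow_two]
    ring
  · have h : ContinuousWithinAt (fun r => r ^ (d - 1) * ψ r) (Set.Ioc 0 π) π :=
      (continuous_pow _).continuousWithinAt.mul (hC2.continuousOn π ⟨Real.pi_pos, le_rfl⟩)
    have h2 : Tendsto (fun r => r ^ (d - 1) * ψ r) (𝓝[<] π) (𝓝 (π ^ (d - 1) * ψ π)) :=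
      (h.mono_of_mem_nhdsWithin
        (mem_of_superset (Ioo_mem_nhdsLT Real.pi_pos) Set.Ioo_subset_Ioc_self)).tendsto
    rwa [hπ, mul_zero] at h2

/-! ### Polar coordinates and null sets of the sphere -/

/-- Integration in spherical coordinates. -/
theorem integral_eq_integral_toSphere_integral_Ioi {E F : Type*} [NormedAddCommGroup E]
    [NormedSpace ℝ E] [FiniteDimensional ℝ E] [Nontrivial E] [MeasurableSpace E] [BorelSpace E]
    [NormedAddCommGroup F] [NormedSpace ℝ F] (μ : Measure E) [μ.IsAddHaarMeasure] {f : E → F}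
    (hf : Integrable f μ) :
    ∫ x, f x ∂μ = ∫ θ, ∫ r in Set.Ioi (0 : ℝ),
      r ^ (Module.finrank ℝ E - 1) • f (r • (θ : E)) ∂volume ∂μ.toSphere := by
  have hmp := μ.measurePreserving_homeomorphUnitSphereProd
  have hme := (homeomorphUnitSphereProd E).measurableEmbedding
  set g : Metric.sphere (0 : E) 1 × Set.Ioi (0 : ℝ) → F := fun z => f (z.2.1 • (z.1 : E))
  have hg : ∀ x : ({0}ᶜ : Set E), g (homeomorphUnitSphereProd E x) = f x := by
    intro x
    have hx : ‖(x : E)‖ ≠ 0 := norm_ne_zero_iff.2 x.2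
    simp [g, smul_smul, hx]
  have hgint : Integrable g (μ.toSphere.prod (.volumeIoiPow (Module.finrank ℝ E - 1))) := by
    rw [← hmp.integrable_comp_emb hme]
    simp only [Function.comp_def, hg]
    exact (integrableOn_iff_comap_subtypeVal (measurableSet_singleton (0 : E)).compl).1
      hf.integrableOn
  calc ∫ x, f x ∂μ = ∫ x : ({0}ᶜ : Set E), f x ∂(μ.comap (↑)) := by
        rw [integral_subtype_comap (measurableSet_singleton _).compl f, restrict_compl_singleton]
    _ = ∫ z, g z ∂μ.toSphere.prod (.volumeIoiPow (Module.finrank ℝ E - 1)) := by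
        rw [← hmp.integral_comp hme]; simp only [hg]
    _ = ∫ θ, ∫ r, g (θ, r) ∂(.volumeIoiPow (Module.finrank ℝ E - 1)) ∂μ.toSphere :=
        integral_prod _ hgint
    _ = _ := by
        refine integral_congr_ae (Eventually.of_forall fun θ => ?_)
        simp only [Measure.volumeIoiPow, ENNReal.ofReal]
        rw [integral_withDensity_eq_integral_smul,
          integral_subtype_comap measurableSet_Ioi
            fun a : ℝ => Real.toNNReal (a ^ (Module.finrank ℝ E - 1)) • f (a • (θ : E)),
          setIntegral_congr_fun measurableSet_Ioi fun x hx => ?_]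
        · rw [NNReal.smul_def, Real.coe_toNNReal _ (pow_nonneg (le_of_lt hx) _)]
        · exact (measurable_subtype_coe.pow_const _).real_toNNReal

/-- Spherical caps of zero width are null sets. -/
theorem toSphere_setOf_add_inner_eq_zero {E : Type*} [NormedAddCommGroup E]
    [InnerProductSpace ℝ E] [FiniteDimensional ℝ E] [MeasurableSpace E] [BorelSpace E]
    (μ : Measure E) [μ.IsAddHaarMeasure] (hE : 1 < Module.finrank ℝ E) (s : ℝ) {y : E}
    (hy : y ≠ 0) : μ.toSphere {θ | s + inner ℝ (θ : E) y = 0} = 0 := by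
  set A : Set E := {q | s * ‖q‖ + inner ℝ q y = 0}
  have hAm : MeasurableSet A := (isClosed_eq (by fun_prop) continuous_const).measurableSet
  -- A direction whose parallel lines all meet the cone `A` countably often makes `A` null. If
  -- $s=0$, `A` is a hyperplane with normal $y$. Otherwise take $v\perp y$: along $q+av$ the norm is
  -- forced to be the constant `c`, so $a$ is a root of a quadratic with leading coefficient
  -- $|v|^2\ne0$.
  have hline : ∃ v : E, ∀ q : E, {a : ℝ | q + a • v ∈ A}.Countable := by
    by_cases hs : s = 0
    · refine ⟨y, fun q => Set.Subsingleton.countable fun a ha b hb => ?_⟩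
      simp only [A, hs, zero_mul, zero_add, Set.mem_ofPred_eq, inner_add_left,
        real_inner_smul_left] at ha hb
      have hyy : inner ℝ y y ≠ (0 : ℝ) := inner_self_ne_zero.2 hy
      exact mul_right_cancel₀ hyy (by linarith)
    · obtain ⟨v, hv, hvy⟩ : ∃ v : E, v ≠ 0 ∧ inner ℝ v y = (0 : ℝ) := by
        have hlt : 0 < Module.finrank ℝ (ℝ ∙ y)ᗮ := by
          have h1 := (ℝ ∙ y).finrank_add_finrank_orthogonal
          have h2 := finrank_span_singleton (K := ℝ) hy
          omega
        have := Module.finrank_pos_iff.1 hlt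
        obtain ⟨w, hw⟩ := exists_ne (0 : (ℝ ∙ y)ᗮ)
        refine ⟨w, by simpa using hw, ?_⟩
        exact Submodule.mem_orthogonal_singleton_iff_inner_left.1 w.2
      refine ⟨v, fun q => ?_⟩
      have hvv : inner ℝ v v ≠ (0 : ℝ) := inner_self_ne_zero.2 hv
      set c : ℝ := -inner ℝ q y / s
      set P : Polynomial ℝ := Polynomial.C (inner ℝ v v) * Polynomial.X ^ 2
        + Polynomial.C (2 * inner ℝ q v) * Polynomial.X + Polynomial.C (inner ℝ q q - c ^ 2)
      have hP : P ≠ 0 := by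
        intro h
        have h3 := congrArg (fun p => Polynomial.coeff p 2) h
        rw [Polynomial.coeff_zero, Polynomial.coeff_add, Polynomial.coeff_add,
          Polynomial.coeff_C_mul_X_pow, Polynomial.coeff_C_mul, Polynomial.coeff_X,
          Polynomial.coeff_C] at h3
        norm_num at h3
        exact hv h3
      refine (P.rootSet_finite ℝ).countable.mono fun a ha => ?_
      simp only [A, Set.mem_ofPred_eq, inner_add_left, real_inner_smul_left, hvy, mul_zero,
        add_zero] at ha
      have h4 : ‖q + a • v‖ = c := by
        rw [eq_div_iff hs]; linarith
      have h5 : inner ℝ (q + a • v) (q + a • v) = c ^ 2 := by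
        rw [real_inner_self_eq_norm_sq, h4]
      simp only [inner_add_left, inner_add_right, real_inner_smul_left,
        real_inner_smul_right, real_inner_comm q v] at h5
      rw [Polynomial.mem_rootSet]
      refine ⟨hP, ?_⟩
      simp only [P, map_add, map_mul, map_pow, Polynomial.aeval_C, Polynomial.aeval_X,
        Algebra.algebraMap_self, RingHom.id_apply]
      rw [real_inner_comm] at h5
      nlinarith [h5, real_inner_comm q v]
  have hA : μ A = 0 := by
    obtain ⟨v, hv⟩ := hline
    have := ae_mem_of_ae_add_linearMap_mem (𝕜 := ℝ) (LinearMap.toSpanSingleton ℝ E v)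
      (volume : Measure ℝ) μ (s := Aᶜ) hAm.compl fun q => by
        have h0 : volume {a : ℝ | q + a • v ∈ A} = 0 := (hv q).measure_zero _
        simpa [ae_iff] using h0
    simpa [ae_iff] using this
  rw [Measure.toSphere_apply']
  · refine mul_eq_zero_of_right _ (measure_mono_null ?_ hA)
    rintro _ ⟨r, hr, _, ⟨θ, hθ, rfl⟩, rfl⟩
    have hθ' : s + inner ℝ (θ : E) y = 0 := hθ
    have hn : ‖(θ : E)‖ = 1 := by simp
    simp only [A, Set.mem_ofPred_eq, norm_smul, hn, Real.norm_of_nonneg hr.1.le,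
      real_inner_smul_left]
    linear_combination r * hθ'
  · exact (isClosed_eq (by fun_prop) continuous_const).measurableSet

/-! ### Bounds on the spherical kernel -/

section Kernel

variable {E : Type*} [NormedAddCommGroup E] [InnerProductSpace ℝ E] [FiniteDimensional ℝ E]
  [MeasurableSpace E] [BorelSpace E] (μ : Measure E) [μ.IsAddHaarMeasure]

/-- The average over the unit sphere of the quadratically decaying kernel `1 / (1 + u ^ 2)` at
the phase `u = t + ⟪θ, x⟫`. -/
noncomputable def sphereKernel (x : E) (t : ℝ) : ℝ :=
  ∫ θ, 1 / (1 + (t + inner ℝ (θ : E) x) ^ 2) ∂μ.toSphere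

theorem integrable_sphereKernel (x : E) (t : ℝ) :
    Integrable (fun θ : Metric.sphere (0 : E) 1 => 1 / (1 + (t + inner ℝ (θ : E) x) ^ 2))
      μ.toSphere := by
  refine Integrable.of_bound (C := 1) (Measurable.aestronglyMeasurable ?_)
    (Eventually.of_forall fun θ => ?_)
  · fun_prop
  · rw [Real.norm_of_nonneg (by positivity)]
    exact div_le_one_of_le₀ (by nlinarith [sq_nonneg (t + inner ℝ (θ : E) x)]) (by positivity)

theorem sphereKernel_le (x : E) (t : ℝ) : sphereKernel μ x t ≤ μ.toSphere.real Set.univ := by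
  refine (integral_mono (integrable_sphereKernel μ x t) (integrable_const (1 : ℝ))
    fun θ => ?_).trans (by simp)
  exact div_le_one_of_le₀ (by nlinarith [sq_nonneg (t + inner ℝ (θ : E) x)]) (by positivity)

theorem sphereKernel_le_of_two_mul_norm_le {x : E} {t : ℝ} (hx : 2 * ‖x‖ ≤ t) :
    sphereKernel μ x t ≤ 4 * μ.toSphere.real Set.univ * (1 + t ^ 2)⁻¹ := by
  refine (integral_mono (integrable_sphereKernel μ x t)
    (integrable_const (4 * (1 + t ^ 2)⁻¹)) fun θ => ?_).trans (le_of_eq ?_)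
  · simp only
    have h1 : |inner ℝ (θ : E) x| ≤ ‖x‖ := by
      simpa using abs_real_inner_le_norm (θ : E) x
    have h2 := (abs_le.1 h1).1
    rw [← div_eq_mul_inv, div_le_div_iff₀ (by positivity) (by positivity)]
    have h3 : t / 2 ≤ t + inner ℝ (θ : E) x := by linarith
    have h0 : 0 ≤ t := le_trans (by positivity) hx
    nlinarith [mul_self_le_mul_self (by positivity : 0 ≤ t / 2) h3]
  · simp; ring

/-- Rescaling by $\delta=1/|x|$ turns the integrand into $\delta^2/(\delta^2+(s+\theta\cdot y)^2)$
with $s=t/|x|\in[0,2]$ and $|y|=1$. Off a null set of $\theta$ it tends to $0$ as $\delta\to0$;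
dominated convergence and compactness in $(s,y)$ make the limit uniform. -/
theorem exists_forall_sphereKernel_le (hE : 1 < Module.finrank ℝ E) {ε : ℝ} (hε : 0 < ε) :
    ∃ T : ℝ, ∀ (x : E) (t : ℝ), T < t → t ≤ 2 * ‖x‖ → sphereKernel μ x t ≤ ε := by
  set Φ : ℝ → ℝ × E → ℝ := fun δ z =>
    ∫ θ, δ ^ 2 / (δ ^ 2 + (z.1 + inner ℝ (θ : E) z.2) ^ 2) ∂μ.toSphere
  have hK : IsCompact (Set.Icc (0 : ℝ) 2 ×ˢ Metric.sphere (0 : E) 1) :=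
    isCompact_Icc.prod (isCompact_sphere _ _)
  have hev : ∀ᶠ δ in 𝓝 (0 : ℝ), ∀ z ∈ Set.Icc (0 : ℝ) 2 ×ˢ Metric.sphere (0 : E) 1,
      Φ δ z < ε := by
    refine hK.eventually_forall_of_forall_eventually fun z hz => ?_
    have hc : ContinuousAt (fun w : ℝ × (ℝ × E) => Φ w.1 w.2) (0, z) := by
      refine continuousAt_of_dominated (bound := fun _ => 1) ?_ ?_ (integrable_const _) ?_
      · exact Eventually.of_forall fun w => Measurable.aestronglyMeasurable (by fun_prop)
      · refine Eventually.of_forall fun w => Eventually.of_forall fun θ => ?_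
        rw [Real.norm_of_nonneg (by positivity)]
        exact div_le_one_of_le₀ (le_add_of_nonneg_right (sq_nonneg _)) (by positivity)
      · have hy : z.2 ≠ 0 := by
          have : ‖z.2‖ = 1 := by simpa using hz.2
          rintro h; simp [h] at this
        have h0 := toSphere_setOf_add_inner_eq_zero μ hE z.1 hy
        have : ∀ᵐ θ : Metric.sphere (0 : E) 1 ∂μ.toSphere, z.1 + inner ℝ (θ : E) z.2 ≠ 0 := by
          simpa [ae_iff] using h0
        filter_upwards [this] with θ hθ
        refine ContinuousAt.div (by fun_prop) (by fun_prop) ?_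
        simpa using hθ
    have h0 : Φ 0 z = 0 := by simp [Φ]
    exact hc.eventually_lt_const (by simpa [h0] using hε)
  obtain ⟨δ, hδ, hδε⟩ := Metric.eventually_nhds_iff.1 hev
  -- $2/\delta<t\le2|x|$ forces $1/|x|<\delta$.
  refine ⟨2 / δ, fun x t ht htx => ?_⟩
  have hx : 1 / δ < ‖x‖ := by
    have : 2 / δ = 2 * (1 / δ) := by ring
    linarith
  have hx0 : 0 < ‖x‖ := lt_trans (by positivity) hx
  have ht0 : 0 < t := lt_trans (by positivity) ht
  have hlt : dist ‖x‖⁻¹ 0 < δ := by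
    rw [Real.dist_0_eq_abs, abs_of_pos (by positivity)]
    rw [one_div] at hx
    exact inv_lt_of_inv_lt₀ hδ hx
  have := hδε hlt (t / ‖x‖, ‖x‖⁻¹ • x) ⟨⟨by positivity, by rw [div_le_iff₀ hx0]; linarith⟩, by
    simp [norm_smul, hx0.ne']⟩
  refine le_trans (le_of_eq ?_) this.le
  refine integral_congr_ae (Eventually.of_forall fun θ => ?_)
  simp only [real_inner_smul_right]
  field_simp

end Kernel

/-! ### From the kernel bound to the time average -/

theorem BosonBath.correlationDecay_of_le_sphereKernel {d : ℕ} (hd : 2 ≤ d) {ι : Type*}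
    (b : ι → BosonBath d) {C : ℝ} (hC : 0 ≤ C)
    (hb : ∀ i (x : Fin d → ℤ) (t : ℝ), ‖(b i).correlation x t‖
      ≤ C * sphereKernel (volume : Measure (EuclideanSpace ℝ (Fin d))) (latticePoint x) t) :
    CorrelationDecay b := by
  have hE : 1 < Module.finrank ℝ (EuclideanSpace ℝ (Fin d)) := by
    rw [finrank_euclideanSpace_fin]; omega
  set σ := (volume : Measure (EuclideanSpace ℝ (Fin d))).toSphere.real Set.univ
  have hσ : 0 ≤ σ := measureReal_nonneg
  rw [CorrelationDecay, ENNReal.tendsto_nhds_zero]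
  intro η hη
  obtain ⟨ε, hε, hεη⟩ : ∃ ε : ℝ, 0 < ε ∧ ENNReal.ofReal (2 * (C * ε)) ≤ η / 2 := by
    have h1 : Tendsto (fun ε : ℝ => ENNReal.ofReal (2 * (C * ε))) (𝓝[>] 0) (𝓝 0) := by
      have : Tendsto (fun ε : ℝ => ENNReal.ofReal (2 * (C * ε))) (𝓝 0)
          (𝓝 (ENNReal.ofReal (2 * (C * 0)))) :=
        (ENNReal.continuous_ofReal.comp (by fun_prop)).tendsto _
      simpa using this.mono_left nhdsWithin_le_nhds
    have h2 := (ENNReal.tendsto_nhds_zero.1 h1 (η / 2) (ENNReal.half_pos hη.ne'))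
    obtain ⟨ε, h3, h4⟩ := (h2.and self_mem_nhdsWithin).exists
    exact ⟨ε, h4, h3⟩
  obtain ⟨T, hT⟩ := exists_forall_sphereKernel_le
    (volume : Measure (EuclideanSpace ℝ (Fin d))) hE hε
  -- Majorants independent of $x$ and $i$: `F1` for $t\ge2|x|$, `F2` for $T<t\le2|x|$, `F3` for
  -- $t\le T$. Only `F2` has an integral growing with $n$, namely $2nC\varepsilon$.
  set F1 : ℝ → ℝ≥0∞ := fun t => ENNReal.ofReal (C * (4 * σ * (1 + t ^ 2)⁻¹))
  set F2 : ℕ → ℝ → ℝ≥0∞ := fun n t => ENNReal.ofReal (C * ε * Real.exp (-(1 / (2 * n)) * t))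
  set F3 : ℝ → ℝ≥0∞ := (Set.Iic T).indicator fun _ => ENNReal.ofReal (C * σ)
  have hpt : ∀ (n : ℕ) (t : ℝ), 0 < t → (⨆ (x : Fin d → ℤ) (i : ι),
      ENNReal.ofReal (‖(b i).correlation x t‖ * Real.exp (-(‖latticePoint x‖ / n))))
      ≤ F1 t + F2 n t + F3 t := by
    intro n t ht
    refine iSup₂_le fun x i => ?_
    have he : Real.exp (-(‖latticePoint x‖ / n)) ≤ 1 :=
      Real.exp_le_one_iff.2 (neg_nonpos.2 (by positivity))
    have hle1 : ‖(b i).correlation x t‖ * Real.exp (-(‖latticePoint x‖ / n))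
        ≤ C * sphereKernel volume (latticePoint x) t := by
      refine (mul_le_of_le_one_right (norm_nonneg _) he).trans (hb i x t)
    rcases le_total (2 * ‖latticePoint x‖) t with h | h
    · refine le_trans (ENNReal.ofReal_le_ofReal (hle1.trans ?_)) (le_self_add.trans le_self_add)
      exact mul_le_mul_of_nonneg_left (sphereKernel_le_of_two_mul_norm_le _ h) hC
    · rcases lt_or_ge T t with hTt | hTt
      · refine le_trans (ENNReal.ofReal_le_ofReal ?_) (le_add_self.trans le_self_add)
        refine mul_le_mul ((hb i x t).trans (mul_le_mul_of_nonneg_left (hT _ _ hTt h) hC))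
          (Real.exp_le_exp.2 ?_) (Real.exp_pos _).le (by positivity)
        have : t / 2 / n ≤ ‖latticePoint x‖ / n := by gcongr; linarith
        have h2 : -(1 / (2 * (n : ℝ))) * t = -(t / 2 / n) := by ring
        linarith
      · have h3 : F3 t = ENNReal.ofReal (C * σ) := Set.indicator_of_mem (s := Set.Iic T) hTt _
        refine le_trans (ENNReal.ofReal_le_ofReal (hle1.trans ?_)) (h3.ge.trans le_add_self)
        exact mul_le_mul_of_nonneg_left (sphereKernel_le _ _ _) hC
  have hF1 : ∫⁻ t in Set.Ioi (0 : ℝ), F1 t < ⊤ := by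
    have h := ((integrable_inv_one_add_sq.const_mul (4 * σ)).const_mul C).integrableOn
      (s := Set.Ioi 0)
    exact (hasFiniteIntegral_iff_ofReal (Eventually.of_forall fun t => by positivity)).1 h.2
  have hF3 : ∫⁻ t in Set.Ioi (0 : ℝ), F3 t < ⊤ := by
    rw [lintegral_indicator_const measurableSet_Iic, Measure.restrict_apply measurableSet_Iic,
      Set.inter_comm, Set.Ioi_inter_Iic]
    exact ENNReal.mul_lt_top ENNReal.ofReal_lt_top measure_Ioc_lt_top
  have hF2 : ∀ n : ℕ, 0 < n → ∫⁻ t in Set.Ioi (0 : ℝ), F2 n t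
      = n * ENNReal.ofReal (2 * (C * ε)) := by
    intro n hn
    have hn' : (0 : ℝ) < n := by exact_mod_cast hn
    have ha : -(1 / (2 * (n : ℝ))) < 0 := neg_lt_zero.2 (by positivity)
    rw [← ofReal_integral_eq_lintegral_ofReal ((integrableOn_exp_mul_Ioi ha 0).const_mul _)
      (Eventually.of_forall fun t => by positivity), integral_const_mul, integral_exp_mul_Ioi ha,
      ← ENNReal.ofReal_natCast, ← ENNReal.ofReal_mul hn'.le]
    congr 1
    simp; ring
  have hlim : Tendsto (fun n : ℕ => (n : ℝ≥0∞)⁻¹ *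
      ((∫⁻ t in Set.Ioi (0 : ℝ), F1 t) + ∫⁻ t in Set.Ioi (0 : ℝ), F3 t)) atTop (𝓝 0) := by
    have := ENNReal.Tendsto.mul_const ENNReal.tendsto_inv_nat_nhds_zero
      (b := (∫⁻ t in Set.Ioi (0 : ℝ), F1 t) + ∫⁻ t in Set.Ioi (0 : ℝ), F3 t)
      (Or.inr (ENNReal.add_lt_top.2 ⟨hF1, hF3⟩).ne)
    simpa using this
  filter_upwards [ENNReal.tendsto_nhds_zero.1 hlim (η / 2) (ENNReal.half_pos hη.ne'),
    eventually_gt_atTop 0] with n hn hn0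
  have hn1 : (n : ℝ≥0∞) ≠ 0 := by exact_mod_cast hn0.ne'
  calc _ ≤ (n : ℝ≥0∞)⁻¹ * ∫⁻ t in Set.Ioi (0 : ℝ), (F1 t + F2 n t + F3 t) := by
        refine mul_le_mul_right ?_ _
        exact setLIntegral_mono_ae' measurableSet_Ioi (Eventually.of_forall fun t ht => hpt n t ht)
    _ = (n : ℝ≥0∞)⁻¹ * ((∫⁻ t in Set.Ioi (0 : ℝ), F1 t) + ∫⁻ t in Set.Ioi (0 : ℝ), F3 t)
        + (n : ℝ≥0∞)⁻¹ * (n * ENNReal.ofReal (2 * (C * ε))) := by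
        rw [lintegral_add_right _ (measurable_const.indicator measurableSet_Iic),
          lintegral_add_left (by fun_prop), hF2 n hn0]
        ring
    _ ≤ η / 2 + η / 2 := by
        rw [← mul_assoc, ENNReal.inv_mul_cancel hn1 (ENNReal.natCast_ne_top n), one_mul]
        gcongr
    _ = η := ENNReal.add_halves η

/-! ### Radial waves -/

theorem sphereKernel_nonneg {E : Type*} [NormedAddCommGroup E] [InnerProductSpace ℝ E]
    [FiniteDimensional ℝ E] [MeasurableSpace E] [BorelSpace E] (μ : Measure E) (x : E) (t : ℝ) :
    0 ≤ sphereKernel μ x t :=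
  integral_nonneg fun _ => by positivity

/-- Gives the wave of opposite phase the same kernel bound. -/
theorem sphereKernel_neg {E : Type*} [NormedAddCommGroup E] [InnerProductSpace ℝ E]
    [FiniteDimensional ℝ E] [MeasurableSpace E] [BorelSpace E] (μ : Measure E) (x : E) (t : ℝ) :
    sphereKernel μ (-x) (-t) = sphereKernel μ x t := by
  refine integral_congr_ae (Eventually.of_forall fun θ => ?_)
  simp only [inner_neg_right]
  congr 2; ring

/-- The wave with phase `⟪q, x⟫ + t ‖q‖` whose amplitude is the radial profile `ψ`, cut off to the
punctured ball of radius `π`. -/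
noncomputable def radialWave {d : ℕ} (ψ : ℝ → ℝ) (x : Momentum d) (t : ℝ) (q : Momentum d) : ℂ :=
  (((Set.Ioo 0 π).indicator ψ ‖q‖ : ℝ) : ℂ)
    * Complex.exp (Complex.I * ((inner ℝ q x + t * ‖q‖ : ℝ) : ℂ))

theorem AdmissibleProfile.exists_norm_integral_radialWave_le {d : ℕ} (hd : 2 ≤ d) {ψ : ℝ → ℝ}
    (hψ : AdmissibleProfile d ψ) (hπ : ψ π = 0) :
    (∀ (x : Momentum d) (t : ℝ), Integrable (radialWave ψ x t)) ∧
    ∃ C : ℝ, 0 ≤ C ∧ ∀ (x : Momentum d) (t : ℝ),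
      ‖∫ q, radialWave ψ x t q‖ ≤ C * sphereKernel volume x t := by
  obtain ⟨hint, C, hC, hdecay⟩ := hψ.exists_norm_fourier_integral_le hd hπ
  have : Nontrivial (Momentum d) := by
    refine Module.nontrivial_of_finrank_pos (R := ℝ) ?_
    rw [finrank_euclideanSpace_fin]; omega
  have hwave : ∀ (x : Momentum d) (t : ℝ), Integrable (radialWave ψ x t) := by
    intro x t
    have h0 : Integrable (fun q : Momentum d => (Set.Ioo 0 π).indicator ψ ‖q‖) := by
      rw [integrable_fun_norm_addHaar, finrank_euclideanSpace_fin]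
      have h := ((integrable_indicator_iff measurableSet_Ioo).2 hint).integrableOn
        (s := Set.Ioi 0)
      refine h.congr_fun (fun r _ => ?_) measurableSet_Ioi
      by_cases hr : r ∈ Set.Ioo 0 π <;> simp [hr]
    refine h0.ofReal.mul_bdd (c := 1) (Continuous.aestronglyMeasurable (by fun_prop))
      (Eventually.of_forall fun q => ?_)
    rw [mul_comm, Complex.norm_exp_ofReal_mul_I]
  refine ⟨hwave, C, hC, fun x t => ?_⟩
  rw [integral_eq_integral_toSphere_integral_Ioi _ (hwave x t), finrank_euclideanSpace_fin,
    sphereKernel, ← integral_const_mul]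
  refine norm_integral_le_of_norm_le ((integrable_sphereKernel volume x t).const_mul C)
    (Eventually.of_forall fun θ => ?_)
  rw [mul_one_div]
  refine le_trans (le_of_eq (congrArg _ ?_)) (hdecay (t + inner ℝ (θ : Momentum d) x))
  have h1 : ∀ r ∈ Set.Ioi (0 : ℝ), r ^ (d - 1) • radialWave ψ x t (r • (θ : Momentum d))
      = (Set.Ioo 0 π).indicator (fun r => ((r ^ (d - 1) * ψ r : ℝ) : ℂ)
        * Complex.exp (Complex.I * (((t + inner ℝ (θ : Momentum d) x) * r : ℝ) : ℂ))) r := by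
    intro r hr
    have hr0 : 0 < r := hr
    have hn : ‖r • (θ : Momentum d)‖ = r := by simp [norm_smul, abs_of_pos hr0]
    have hp : inner ℝ (r • (θ : Momentum d)) x + t * r
        = (t + inner ℝ (θ : Momentum d) x) * r := by
      rw [real_inner_smul_left]; ring
    rw [radialWave, hn, hp]
    by_cases hr' : r ∈ Set.Ioo 0 π
    · rw [Set.indicator_of_mem hr', Set.indicator_of_mem hr', Complex.real_smul]
      push_cast; ring
    · rw [Set.indicator_of_notMem hr', Set.indicator_of_notMem hr']; simp
  rw [setIntegral_congr_fun measurableSet_Ioi h1, setIntegral_indicator measurableSet_Ioo,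
    Set.inter_eq_right.2 Set.Ioo_subset_Ioi_self]

/-! ### Correlation functions as sums of radial waves -/

theorem measurableSet_torusCube (d : ℕ) : MeasurableSet (torusCube d) := by
  have : torusCube d = ⋂ j, (fun q : Momentum d => q j) ⁻¹' Set.Ioc (-π) π := by
    ext q; simp [torusCube]
  rw [this]
  exact MeasurableSet.iInter fun j => measurableSet_Ioc.preimage (by fun_prop)

theorem pi_le_norm_of_notMem_torusCube {d : ℕ} {q : Momentum d} (hq : q ∉ torusCube d) :
    π ≤ ‖q‖ := by
  by_contra! h
  refine hq fun j => ?_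
  have h1 : |q j| ≤ ‖q‖ := PiLp.norm_apply_le q j
  have h2 := abs_lt.1 (h1.trans_lt h)
  exact ⟨h2.1, h2.2.le⟩

namespace BosonBath

variable {d : ℕ} {b : BosonBath d}

theorem formFactor_eq_zero_of_pi_le_norm
    (hsupp : tsupport b.formFactor ∩ torusCube d ⊆ Metric.ball 0 π) {q : Momentum d}
    (hq : q ∈ torusCube d) (hπ : π ≤ ‖q‖) : b.formFactor q = 0 := by
  by_contra h
  have := hsupp ⟨subset_tsupport _ h, hq⟩
  rw [mem_ball_zero_iff] at this
  linarith

/-- Where $g_0\ne0$, the support conditions give $|q|<\pi$ and $\nu(q)=|q|$; where $g_0=0$, both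
cut-off profiles vanish. The origin is excluded because the profiles are not tied to $g_0$ and
$\zeta$ there. -/
theorem correlationIntegrand_eq_radialWave
    (hsupp : tsupport b.formFactor ∩ torusCube d ⊆ Metric.ball 0 π)
    (hlin : ∀ q ∈ tsupport b.formFactor ∩ torusCube d, b.dispersion q = ‖q‖)
    {ψplus ψminus : ℝ → ℝ}
    (hψplus : ∀ q : Momentum d, 0 < ‖q‖ → ‖q‖ ≤ π →
      ψplus ‖q‖ = ‖b.formFactor q‖ ^ 2 * b.occupation q)
    (hψminus : ∀ q : Momentum d, 0 < ‖q‖ → ‖q‖ ≤ π →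
      ψminus ‖q‖ = ‖b.formFactor q‖ ^ 2 * (1 + b.occupation q))
    (x : Fin d → ℤ) (t : ℝ) {q : Momentum d} (hq : q ∈ torusCube d) (hq0 : q ≠ 0) :
    b.correlationIntegrand x t q = radialWave ψplus (latticePoint x) t q
      + radialWave ψminus (-latticePoint x) (-t) q := by
  have hq0' : 0 < ‖q‖ := norm_pos_iff.2 hq0
  by_cases hg : b.formFactor q = 0
  · have h : ∀ ψ : ℝ → ℝ, (‖q‖ ≤ π → ψ ‖q‖ = 0) → ∀ (y : Momentum d) (s : ℝ),
        radialWave ψ y s q = 0 := by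
      intro ψ hψ y s
      have : (Set.Ioo 0 π).indicator ψ ‖q‖ = 0 :=
        Set.indicator_apply_eq_zero.2 fun hm => hψ hm.2.le
      rw [radialWave, this, Complex.ofReal_zero, zero_mul]
    rw [h ψplus (fun hle => by simp [hψplus q hq0' hle, hg]),
      h ψminus (fun hle => by simp [hψminus q hq0' hle, hg])]
    simp [correlationIntegrand, hg]
  · have hlt : ‖q‖ < π := by
      by_contra! h
      exact hg (formFactor_eq_zero_of_pi_le_norm hsupp hq h)
    have hmem : ‖q‖ ∈ Set.Ioo 0 π := ⟨hq0', hlt⟩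
    rw [correlationIntegrand, hlin q ⟨subset_tsupport _ hg, hq⟩, radialWave, radialWave,
      Set.indicator_of_mem hmem, Set.indicator_of_mem hmem, hψplus q hq0' hlt.le,
      hψminus q hq0' hlt.le, inner_neg_right]
    have e1 : Complex.exp (Complex.I * ((inner ℝ q (latticePoint x) + t * ‖q‖ : ℝ) : ℂ))
        = Complex.exp (Complex.I * ((inner ℝ q (latticePoint x) : ℝ) : ℂ))
          * Complex.exp (Complex.I * ((t * ‖q‖ : ℝ) : ℂ)) := by
      rw [← Complex.exp_add]; push_cast; ring_nf
    have e2 : Complex.exp (Complex.I * ((-inner ℝ q (latticePoint x) + -t * ‖q‖ : ℝ) : ℂ))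
        = Complex.exp (-(Complex.I * ((inner ℝ q (latticePoint x) : ℝ) : ℂ)))
          * Complex.exp (-(Complex.I * ((t * ‖q‖ : ℝ) : ℂ))) := by
      rw [← Complex.exp_add]; push_cast; ring_nf
    rw [e1, e2]
    push_cast; ring

theorem exists_norm_correlation_le (hd : 2 ≤ d)
    (hsupp : tsupport b.formFactor ∩ torusCube d ⊆ Metric.ball 0 π)
    (hlin : ∀ q ∈ tsupport b.formFactor ∩ torusCube d, b.dispersion q = ‖q‖)
    {ψplus ψminus : ℝ → ℝ}
    (hψplus : ∀ q : Momentum d, 0 < ‖q‖ → ‖q‖ ≤ π →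
      ψplus ‖q‖ = ‖b.formFactor q‖ ^ 2 * b.occupation q)
    (hψminus : ∀ q : Momentum d, 0 < ‖q‖ → ‖q‖ ≤ π →
      ψminus ‖q‖ = ‖b.formFactor q‖ ^ 2 * (1 + b.occupation q))
    (hplus : AdmissibleProfile d ψplus) (hminus : AdmissibleProfile d ψminus) :
    (∀ (x : Fin d → ℤ) (t : ℝ), IntegrableOn (b.correlationIntegrand x t) (torusCube d)) ∧
    ∃ C : ℝ, ∀ (x : Fin d → ℤ) (t : ℝ),
      ‖b.correlation x t‖ ≤ C * sphereKernel volume (latticePoint x) t := by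
  have : Nontrivial (Momentum d) := by
    refine Module.nontrivial_of_finrank_pos (R := ℝ) ?_
    rw [finrank_euclideanSpace_fin]; omega
  obtain ⟨hψplus_pi, hψminus_pi⟩ : ψplus π = 0 ∧ ψminus π = 0 := by
    -- The point $\pi e_0$ lies in the half-open cube but outside the open ball, so $g_0$ vanishes
    -- there.
    set q : Momentum d := EuclideanSpace.single ⟨0, by omega⟩ π
    have hq : ‖q‖ = π := by simp [q, abs_of_pos Real.pi_pos]
    have hqc : q ∈ torusCube d := by
      intro j
      have := Real.pi_pos
      by_cases hj : j = ⟨0, by omega⟩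
      · simp only [q, hj, PiLp.single_apply, if_true, Set.mem_Ioc]
        exact ⟨by linarith, le_rfl⟩
      · simp only [q, hj, PiLp.single_apply, if_false, Set.mem_Ioc]
        exact ⟨by linarith, this.le⟩
    have hg := formFactor_eq_zero_of_pi_le_norm hsupp hqc hq.ge
    have h1 := hψplus q (hq ▸ Real.pi_pos) hq.le
    have h2 := hψminus q (hq ▸ Real.pi_pos) hq.le
    rw [hq, hg] at h1 h2
    simp [h1, h2]
  obtain ⟨hintp, Cp, hCp, hbp⟩ := hplus.exists_norm_integral_radialWave_le hd hψplus_pi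
  obtain ⟨hintm, Cm, hCm, hbm⟩ := hminus.exists_norm_integral_radialWave_le hd hψminus_pi
  have hae : ∀ (x : Fin d → ℤ) (t : ℝ), ∀ᵐ q ∂(volume.restrict (torusCube d)),
      b.correlationIntegrand x t q = radialWave ψplus (latticePoint x) t q
        + radialWave ψminus (-latticePoint x) (-t) q := by
    intro x t
    have h0 : ∀ᵐ q : Momentum d ∂(volume.restrict (torusCube d)), q ≠ 0 :=
      ae_restrict_of_ae (compl_mem_ae_iff.2 (measure_singleton 0))
    filter_upwards [h0, ae_restrict_mem (measurableSet_torusCube d)] with q hq0 hq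
    exact correlationIntegrand_eq_radialWave hsupp hlin hψplus hψminus x t hq hq0
  refine ⟨fun x t => ?_, ((2 * π) ^ d)⁻¹ * (Cp + Cm), fun x t => ?_⟩
  · exact ((hintp _ _).add (hintm _ _)).integrableOn.congr ((hae x t).mono fun q hq => hq.symm)
  -- The open ball of radius $\pi$ lies in the cube, so the cut-off waves may be integrated over all
  -- of $\mathbb R^d$.
  · have hzero : ∀ (ψ : ℝ → ℝ) (y : Momentum d) (s : ℝ) (q : Momentum d), q ∉ torusCube d →
        radialWave ψ y s q = 0 := by
      intro ψ y s q hq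
      have : (Set.Ioo 0 π).indicator ψ ‖q‖ = 0 := Set.indicator_of_notMem
        (fun h => h.2.not_ge (pi_le_norm_of_notMem_torusCube hq)) ψ
      rw [radialWave, this, Complex.ofReal_zero, zero_mul]
    have hI : ∫ q in torusCube d, b.correlationIntegrand x t q
        = (∫ q, radialWave ψplus (latticePoint x) t q)
          + ∫ q, radialWave ψminus (-latticePoint x) (-t) q := by
      rw [integral_congr_ae (hae x t), setIntegral_eq_integral_of_forall_compl_eq_zero,
        integral_add (hintp _ _) (hintm _ _)]
      intro q hq
      rw [hzero _ _ _ q hq, hzero _ _ _ q hq, add_zero]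
    have h1 := hbp (latticePoint x) t
    have h2 := hbm (-latticePoint x) (-t)
    rw [sphereKernel_neg] at h2
    rw [correlation, hI, norm_mul, norm_inv, Complex.norm_real,
      Real.norm_of_nonneg (by positivity), mul_assoc]
    refine mul_le_mul_of_nonneg_left ((norm_add_le _ _).trans ?_) (by positivity)
    linarith

end BosonBath

theorem mainTheorem3 {d : ℕ} (hd : 2 ≤ d) {ι : Type*} [Finite ι] (b : ι → BosonBath d)
    (hsupp : ∀ i, tsupport (b i).formFactor ∩ torusCube d ⊆ Metric.ball 0 π)
    (hrad : ∀ i, (b i).IsRadial)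
    (hlin : ∀ i, ∀ q ∈ tsupport (b i).formFactor ∩ torusCube d, (b i).dispersion q = ‖q‖)
    (ψplus ψminus : ι → ℝ → ℝ)
    (hψplus : ∀ i (q : Momentum d), 0 < ‖q‖ → ‖q‖ ≤ π →
      ψplus i ‖q‖ = ‖(b i).formFactor q‖ ^ 2 * (b i).occupation q)
    (hψminus : ∀ i (q : Momentum d), 0 < ‖q‖ → ‖q‖ ≤ π →
      ψminus i ‖q‖ = ‖(b i).formFactor q‖ ^ 2 * (1 + (b i).occupation q))
    (hplus : ∀ i, AdmissibleProfile d (ψplus i))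
    (hminus : ∀ i, AdmissibleProfile d (ψminus i)) :
    (∀ i (x : Fin d → ℤ) (t : ℝ),
      IntegrableOn ((b i).correlationIntegrand x t) (torusCube d)) ∧
    CorrelationDecay b := by
  have h := fun i => BosonBath.exists_norm_correlation_le hd (hsupp i) (hlin i) (hψplus i)
    (hψminus i) (hplus i) (hminus i)
  refine ⟨fun i => (h i).1, ?_⟩
  choose C hC using fun i => (h i).2
  obtain ⟨M, hM⟩ := (Set.finite_range C).bddAbove
  -- One constant serves the finite family; the maximum with $0$ ensures nonnegativity even for an
  -- empty family.
  refine BosonBath.correlationDecay_of_le_sphereKernel hd b (le_max_right M 0) fun i x t => ?_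
  exact (hC i x t).trans (mul_le_mul_of_nonneg_right
    ((hM (Set.mem_range_self i)).trans (le_max_left _ _)) (sphereKernel_nonneg _ _ _))
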